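/- Let $K$ be a field and $n$ a natural number. Let $K[\mathbf x,z]$ be the polynomial ring over $K$ in the variable $z$ and the variables $x_{ij}^{pq}$ with $1\le i<j\le n$ and $p,q\in\{+,-\}$; for $j<i$ write $x_{ij}^{pq}:=x_{ji}^{qp}$. Let $\pi:K[\mathbf x,z]\to K[t_1^{\pm1},\dots,t_n^{\pm1},s]$ be the $K$-algebra homomorphism with $\pi(z)=s$ and $\pi(x_{ij}^{pq})=t_i^{p'}t_j^{q'}s$, where $+'=1$ and $-'=-1$. The toric ideal $I_{\mathbf D_n^\pm}:=\ker\pi$ is the toric ideal of the centrally symmetric configuration of the root system $D_n$, which consists of the origin and the vectors $\pm\mathbf e_i\pm\mathbf e_j$ ($1\le i<j\le n$), each lifted by a last coordinate $1$. Fix any linear ordering $<$ of the variables $x_{ij}^{pq}$ ($i<j$) such that $x_{ij}^{pq}<x_{k\ell}^{rs}$ whenever $i<k$, or $i=k$ and $j>\ell$. Let $<_{\rm lex}$ be the induced lexicographic order on the monomials in the variables $x_{ij}^{pq}$: $u<_{\rm lex}v$ if, at the largest variable whose exponents in $u$ and $v$ differ, the exponent in $u$ is the smaller one. For monomials $u,v$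 in the variables $x_{ij}^{pq}$, of degrees $a$ and $b$, and $\alpha,\beta\ge0$, put $uz^\alpha\prec vz^\beta$ if $a+\alpha<b+\beta$; or $a+\alpha=b+\beta$ and $\alpha>\beta$; or $a=b$, $\alpha=\beta$ and $u<_{\rm lex}v$. This is a monomial order on $K[\mathbf x,z]$. Let $\mathcal G$ be the set of the following binomials, where $p,q,r,s$ range over $\{+,-\}$: (i) $x_{ij}^{pq}x_{k\ell}^{rs}-x_{ik}^{pr}x_{j\ell}^{qs}$, for $1\le i<j<k<\ell\le n$; (ii) $x_{i\ell}^{ps}x_{jk}^{qr}-x_{ik}^{pr}x_{j\ell}^{qs}$, for $1\le i<j<k<\ell\le n$; (iii) $x_{ij}^{+p}x_{ik}^{-q}-x_{jk}^{pq}z$, for $1\le i,j,k\le n$ pairwise distinct; (iv) $x_{ij}^{++}x_{ij}^{--}-z^2$, for $1\le i<j\le n$; (v) $x_{ij}^{+-}x_{ij}^{-+}-z^2$, for $1\le i<j\le n$; (vi) $x_{ij}^{p+}x_{ij}^{p-}-x_{1i}^{+p}x_{1i}^{-p}$, for $1<i,j\le n$ with $i\ne j$; (vii) $x_{1j}^{p+}x_{1j}^{p-}-x_{1n}^{p+}x_{1n}^{p-}$,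 for $1<j<n$; (viii) $x_{1i}^{+p}x_{1i}^{-p}x_{jk}^{qr}-x_{ij}^{pq}x_{ik}^{pr}z$, for $1<i,j,k\le n$ pairwise distinct. Then $\mathcal G$ is a Gröbner basis of $I_{\mathbf D_n^\pm}$ with respect to $\prec$; that is, $\mathcal G$ is a finite set of nonzero elements of $I_{\mathbf D_n^\pm}$ whose initial terms generate the initial ideal of $I_{\mathbf D_n^\pm}$. -/

import Mathlib

/-- The index of a variable `x_{ij}^{pq}` with `i < j` in `{1, …, n}` and signs `p, q = ±1`.
The set `{1, …, n}` is represented by `Fin n`, so that the index `1` is the element with value `0`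
and the index `n` is the element with value `n - 1`. -/
@[ext]
structure XVar (n : ℕ) where
  i : Fin n
  j : Fin n
  lt : i < j
  p : ℤˣ
  q : ℤˣ

instance XVar.instFinite (n : ℕ) : Finite (XVar n) :=
  Finite.of_injective
    (fun v : XVar n => ((v.i, v.j, v.p, v.q) : Fin n × Fin n × ℤˣ × ℤˣ)) (by
      intro v w h
      simp only [Prod.mk.injEq] at h
      exact XVar.ext h.1 h.2.1 h.2.2.1 h.2.2.2)

/-- The variables of `K[x, z]`: `some v` is the variable `x_v` and `none` is `z`. -/
abbrev DVar (n : ℕ) : Type := Option (XVar n)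

/-- The variable `z` of `K[x, z]`. -/
noncomputable def zPoly (K : Type*) [Field K] (n : ℕ) : MvPolynomial (DVar n) K :=
  MvPolynomial.X none

/-- The variable `x_{ij}^{pq}` of `K[x, z]`, where `x_{ij}^{pq}` means `x_{ji}^{qp}` for `j < i`
(the value `0` at `i = j` is a default that is never used). -/
noncomputable def xPoly (K : Type*) [Field K] {n : ℕ} (i j : Fin n) (p q : ℤˣ) :
    MvPolynomial (DVar n) K :=
  if h : i < j then MvPolynomial.X (some ⟨i, j, h, p, q⟩)
  else if h' : j < i then MvPolynomial.X (some ⟨j, i, h', q, p⟩)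
  else 0

/-- The ring `K[t₁, …, tₙ, t₁⁻¹, …, tₙ⁻¹, s]`, as the monoid algebra of `ℤⁿ × ℕ`:
the basis element at `(a, b)` is the monomial `t^a s^b`. -/
abbrev LaurentRing (K : Type*) [Field K] (n : ℕ) : Type _ :=
  AddMonoidAlgebra K ((Fin n → ℤ) × ℕ)

/-- The exponent of the image of a variable: `z ↦ s` and `x_{ij}^{pq} ↦ t_i^p t_j^q s`. -/
def varExponent {n : ℕ} : DVar n → (Fin n → ℤ) × ℕ
  | none => (0, 1)
  | some v => (Pi.single v.i (v.p : ℤ) + Pi.single v.j (v.q : ℤ), 1)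

/-- The ring homomorphism `π : K[x, z] → K[t, t⁻¹, s]`, whose image is the toric ring. -/
noncomputable def toricMap (K : Type*) [Field K] (n : ℕ) :
    MvPolynomial (DVar n) K →ₐ[K] LaurentRing K n :=
  MvPolynomial.aeval fun v => AddMonoidAlgebra.single (varExponent v) (1 : K)

/-- The toric ideal of the centrally symmetric configuration of the root system `D_n`. -/
noncomputable def toricIdeal (K : Type*) [Field K] (n : ℕ) : Ideal (MvPolynomial (DVar n) K) :=
  RingHom.ker (toricMap K n)

/-- The condition on the ordering of the variables `x_{ij}^{pq}`: `x_{ij}^{pq} < x_{kl}^{rs}` if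
`i < k`, or `i = k` and `j > l`. Variables with the same `i, j` may be ordered in any way. -/
def IsAdmissibleOrder {n : ℕ} [LinearOrder (XVar n)] : Prop :=
  ∀ v w : XVar n, (v.i < w.i ∨ (v.i = w.i ∧ w.j < v.j)) → v < w

/-- The data by which monomials are compared lexicographically: the total degree, the degree in
the variables `x` (for equal total degree, it is larger when the `z`-degree is smaller), and the
`x`-part, compared at the largest variable at which the exponents differ. -/
noncomputable def orderKey {n : ℕ} (u : DVar n →₀ ℕ) : ℕ ×ₗ (ℕ ×ₗ Colex (XVar n →₀ ℕ)) :=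
  toLex (u.some.degree + u none, toLex (u.some.degree, toColex u.some))

theorem orderKey_injective {n : ℕ} : Function.Injective (orderKey (n := n)) := by
  intro u v h
  simp only [orderKey, EmbeddingLike.apply_eq_iff_eq, Prod.mk.injEq] at h
  obtain ⟨h1, h2, h3⟩ := h
  refine Finsupp.ext fun a => ?_
  cases a with
  | none => omega
  | some a => exact DFunLike.congr_fun h3 a

theorem orderKey_add {n : ℕ} (u v : DVar n →₀ ℕ) :
    orderKey (u + v) = orderKey u + orderKey v := by
  simp only [orderKey, Finsupp.some_add, Finsupp.add_apply, map_add]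
  rw [add_add_add_comm]
  rfl

theorem orderKey_zero {n : ℕ} : orderKey (0 : DVar n →₀ ℕ) = 0 := by
  simp only [orderKey, Finsupp.some_zero, Finsupp.coe_zero, Pi.zero_apply, map_zero]
  rfl

theorem orderKey_lt_iff {n : ℕ} [LinearOrder (XVar n)] (u v : DVar n →₀ ℕ) :
    orderKey u < orderKey v ↔
      u.some.degree + u none < v.some.degree + v none ∨
      (u.some.degree + u none = v.some.degree + v none ∧ v none < u none) ∨
      (u.some.degree = v.some.degree ∧ u none = v none ∧
        ∃ w : XVar n, (∀ w' : XVar n, w < w' → u (some w') = v (some w')) ∧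
          u (some w) < v (some w)) := by
  have h : toColex u.some < toColex v.some ↔
      ∃ w : XVar n, (∀ w' : XVar n, w < w' → u (some w') = v (some w')) ∧
          u (some w) < v (some w) := Iff.rfl
  simp only [orderKey, Prod.Lex.toLex_lt_toLex, h]
  constructor
  · rintro (h1 | ⟨h1, h2 | ⟨h2, h3⟩⟩)
    · exact Or.inl h1
    · exact Or.inr (Or.inl ⟨h1, by omega⟩)
    · exact Or.inr (Or.inr ⟨h2, by omega, h3⟩)
  · rintro (h1 | ⟨h1, h2⟩ | ⟨h1, h2, h3⟩)
    · exact Or.inl h1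
    · exact Or.inr ⟨h1, Or.inl (by omega)⟩
    · exact Or.inr ⟨by omega, Or.inr ⟨h1, h3⟩⟩

/-- Exponent vectors of the monomials of `K[x, z]`, a type synonym that carries the order `≺`. -/
def DMonomials (n : ℕ) : Type := DVar n →₀ ℕ

noncomputable instance DMonomials.instAddCommMonoid (n : ℕ) : AddCommMonoid (DMonomials n) :=
  inferInstanceAs (AddCommMonoid (DVar n →₀ ℕ))

noncomputable instance DMonomials.instLinearOrder (n : ℕ) [LinearOrder (XVar n)] :
    LinearOrder (DMonomials n) :=
  LinearOrder.lift' (β := ℕ ×ₗ (ℕ ×ₗ Colex (XVar n →₀ ℕ))) (orderKey (n := n))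
    orderKey_injective

instance DMonomials.instIsOrderedAddMonoid (n : ℕ) [LinearOrder (XVar n)] :
    IsOrderedAddMonoid (DMonomials n) where
  add_le_add_left a b h c := by
    have h' : orderKey (n := n) a + orderKey (n := n) c ≤
        orderKey (n := n) b + orderKey (n := n) c :=
      add_le_add_left (show orderKey (n := n) a ≤ orderKey (n := n) b from h) _
    erw [← orderKey_add, ← orderKey_add] at h'
    exact h'

instance DMonomials.instWellFoundedLT (n : ℕ) [LinearOrder (XVar n)] :
    WellFoundedLT (DMonomials n) :=
  ⟨InvImage.wf (orderKey (n := n))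
    (wellFounded_lt (α := ℕ ×ₗ (ℕ ×ₗ Colex (XVar n →₀ ℕ))))⟩

/-- The monomial order `≺` on `K[x, z]` induced by the given ordering of the variables `x`. -/
noncomputable def dOrder (n : ℕ) [LinearOrder (XVar n)] : MonomialOrder (DVar n) where
  syn := DMonomials n
  toSyn := { toEquiv := Equiv.refl (DVar n →₀ ℕ), map_add' := fun _ _ => rfl }
  toSyn_monotone := by
    intro a b h
    obtain ⟨c, rfl⟩ := exists_add_of_le h
    change orderKey a ≤ orderKey (a + c)
    rw [orderKey_add]
    refine le_add_of_nonneg_right ?_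
    rw [← orderKey_zero]
    refine not_lt.mp fun hlt => ?_
    rw [orderKey_lt_iff] at hlt
    simp only [Finsupp.some_zero, map_zero, Finsupp.coe_zero, Pi.zero_apply, not_lt_zero,
      and_false, exists_false, or_false] at hlt
    omega

open scoped MonomialOrder in
/-- The order `≺` written out: compare total degrees first, then the `z`-degrees (the larger
`z`-degree is smaller), then the `x`-parts lexicographically. -/
theorem dOrder_lt_iff (n : ℕ) [LinearOrder (XVar n)] (u v : DVar n →₀ ℕ) :
    u ≺[dOrder n] v ↔
      u.some.degree + u none < v.some.degree + v none ∨
      (u.some.degree + u none = v.some.degree + v none ∧ v none < u none) ∨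
      (u.some.degree = v.some.degree ∧ u none = v none ∧
        ∃ w : XVar n, (∀ w' : XVar n, w < w' → u (some w') = v (some w')) ∧
          u (some w) < v (some w)) :=
  orderKey_lt_iff u v

/-- `G` is a Gröbner basis of the ideal `I` with respect to `m`: a finite set of nonzero elements
of `I` whose leading terms generate the initial ideal of `I`. -/
def IsGroebnerBasis {σ K : Type*} [Field K] (m : MonomialOrder σ)
    (I : Ideal (MvPolynomial σ K)) (G : Set (MvPolynomial σ K)) : Prop :=
  G.Finite ∧ (0 : MvPolynomial σ K) ∉ G ∧ G ⊆ I ∧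
    Ideal.span (m.leadingTerm '' G) = Ideal.span (m.leadingTerm '' (I : Set (MvPolynomial σ K)))

/-- Membership in the set of binomials. Here `o` stands for the index `1` and `e` for the
index `n`. -/
inductive IsDBinomial (K : Type*) [Field K] {n : ℕ} : MvPolynomial (DVar n) K → Prop
  | i (i j k l : Fin n) (p q r s : ℤˣ) (hij : i < j) (hjk : j < k) (hkl : k < l) :
      IsDBinomial K (xPoly K i j p q * xPoly K k l r s - xPoly K i k p r * xPoly K j l q s)
  | ii (i j k l : Fin n) (p q r s : ℤˣ) (hij : i < j) (hjk : j < k) (hkl : k < l) :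
      IsDBinomial K (xPoly K i l p s * xPoly K j k q r - xPoly K i k p r * xPoly K j l q s)
  | iii (i j k : Fin n) (p q : ℤˣ) (hij : i ≠ j) (hik : i ≠ k) (hjk : j ≠ k) :
      IsDBinomial K (xPoly K i j 1 p * xPoly K i k (-1) q - xPoly K j k p q * zPoly K n)
  | iv (i j : Fin n) (hij : i < j) :
      IsDBinomial K (xPoly K i j 1 1 * xPoly K i j (-1) (-1) - zPoly K n ^ 2)
  | v (i j : Fin n) (hij : i < j) :
      IsDBinomial K (xPoly K i j 1 (-1) * xPoly K i j (-1) 1 - zPoly K n ^ 2)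
  | vi (o i j : Fin n) (p : ℤˣ) (ho : o.val = 0) (hi : o < i) (hj : o < j) (hij : i ≠ j) :
      IsDBinomial K
        (xPoly K i j p 1 * xPoly K i j p (-1) - xPoly K o i 1 p * xPoly K o i (-1) p)
  | vii (o e j : Fin n) (p : ℤˣ) (ho : o.val = 0) (he : e.val + 1 = n) (hj : o < j) (hj' : j < e) :
      IsDBinomial K
        (xPoly K o j p 1 * xPoly K o j p (-1) - xPoly K o e p 1 * xPoly K o e p (-1))
  | viii (o i j k : Fin n) (p q r : ℤˣ) (ho : o.val = 0) (hi : o < i) (hj : o < j) (hk : o < k)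
      (hij : i ≠ j) (hik : i ≠ k) (hjk : j ≠ k) :
      IsDBinomial K
        (xPoly K o i 1 p * xPoly K o i (-1) p * xPoly K j k q r -
          xPoly K i j p q * xPoly K i k p r * zPoly K n)

/-- The set of all binomials of the eight types. -/
def dBinomials (K : Type*) [Field K] (n : ℕ) : Set (MvPolynomial (DVar n) K) :=
  {f | IsDBinomial K f}

/-!
The binomials lie in the kernel of `π`, and each is a difference of two monomials whose larger one
for `≺` is the first one in its definition. By division with remainder it suffices that a polynomial
in the kernel vanishes if none of its monomials is divisible by one of these initial monomials. This
holds because two such *standard* monomials with the same image under `π` are equal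
(`IsStandard.eq_of_weight_eq`).

The `x`-part of a monomial is a signed multigraph on the vertices `1, …, n`, encoded as a multiset
`M` of variables: the edge `x_{ij}^{pq}` has the half-edges `(i, p)` and `(j, q)`. Let `a` be the
exponent of `t` in the image, and call a vertex pure if only one sign occurs at it.

* If all vertices are pure, the half-edges of `M` can be read off from `a`, and `2 |M| = ∑ |a_i|`,
  so that `2 |a_c| ≤ ∑ |a_i|` for every vertex `c`. No two edges are separated or nested
  (`not_separated`, `not_nested`), so any two share a vertex or cross. Hence the edges form a chain
  in the product order and every smaller endpoint is at most every larger endpoint. So in the sorted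
  list of all endpoints the first half consists of the smaller endpoints and the second half of the
  larger ones, each in the order of the edges, and the endpoints determine the edges
  (`eq_of_map_fst_add_map_snd_eq`).
* If both signs occur at a vertex `w`, then `M` is a star: there is a half-edge `(c, p)` that
  belongs to all edges, all vertices other than `w` are pure, and either `w = 1`, or `c = 1` and `w = n`
  (`IsStandard.isStar`). Then `|M| = |a_c|` and `2 |a_c| > ∑ |a_i|`; this inequality separates this
  case from the first one and determines `c`, hence `w`. The sign of `a_c` is `p`, and `a` and `|M|`
  determine the half-edges, hence the edges, each of which consists of `(c, p)` and one other
  half-edge.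

The exponent of `z` is then determined by the total degree.
-/

/-! ### Signed multigraphs and standard monomials -/

variable {n : ℕ}

/-- The number of edges of the signed multigraph `M` that have the half-edge `(i, p)`, that is,
whose variable `x` maps to a monomial with a factor `t_i ^ p`. -/
def halfCount (M : Multiset (XVar n)) (i : Fin n) (p : ℤˣ) : ℕ :=
  M.countP fun v => (v.i = i ∧ v.p = p) ∨ (v.j = i ∧ v.q = p)

/-- The exponent of `t` in the image of the monomial that corresponds to `M`. -/
def weight (M : Multiset (XVar n)) : Fin n → ℤ :=
  (M.map fun v => (Pi.single v.i (v.p : ℤ) + Pi.single v.j (v.q : ℤ) : Fin n → ℤ)).sum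

/-- `M` has an edge with the half-edges `(i, p)` and `(j, q)`: the variable `x_{ij}^{pq}`, with the
convention `x_{ij}^{pq} = x_{ji}^{qp}`, divides the monomial. -/
def HasEdge (M : Multiset (XVar n)) (i j : Fin n) (p q : ℤˣ) : Prop :=
  ∃ v ∈ M, (v.i = i ∧ v.j = j ∧ v.p = p ∧ v.q = q) ∨ (v.i = j ∧ v.j = i ∧ v.p = q ∧ v.q = p)

/-- No initial monomial of one of the binomials divides the monomial that corresponds to `M`. -/
structure IsStandard (M : Multiset (XVar n)) : Prop where
  not_separated : ∀ i j k l p q r s, i < j → j < k → k < l →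
    HasEdge M i j p q → ¬ HasEdge M k l r s
  not_nested : ∀ i j k l p q r s, i < j → j < k → k < l →
    HasEdge M i l p s → ¬ HasEdge M j k q r
  not_opposite_at : ∀ i j k p q, i ≠ j → i ≠ k → j ≠ k →
    HasEdge M i j 1 p → ¬ HasEdge M i k (-1) q
  not_opposite : ∀ i j p q, HasEdge M i j p q → ¬ HasEdge M i j (-p) (-q)
  not_square : ∀ o i j : Fin n, ∀ p, o.val = 0 → o < i → o < j → i ≠ j →
    HasEdge M i j p 1 → ¬ HasEdge M i j p (-1)
  not_square_first : ∀ o e j : Fin n, ∀ p, o.val = 0 → e.val + 1 = n → o < j → j < e →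
    HasEdge M o j p 1 → ¬ HasEdge M o j p (-1)
  not_square_mul : ∀ o i j k : Fin n, ∀ p q r, o.val = 0 → o < i → o < j → o < k →
    i ≠ j → i ≠ k → j ≠ k → HasEdge M o i 1 p → HasEdge M o i (-1) p → ¬ HasEdge M j k q r

theorem HasEdge.symm {M : Multiset (XVar n)} {i j : Fin n} {p q : ℤˣ} (h : HasEdge M i j p q) :
    HasEdge M j i q p := by
  obtain ⟨v, hv, h | h⟩ := h
  · exact ⟨v, hv, Or.inr h⟩
  · exact ⟨v, hv, Or.inl h⟩

theorem HasEdge.ne {M : Multiset (XVar n)} {i j : Fin n} {p q : ℤˣ} (h : HasEdge M i j p q) :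
    i ≠ j := by
  obtain ⟨v, hv, h | h⟩ := h <;> have := v.lt <;> grind

theorem hasEdge_of_mem {M : Multiset (XVar n)} {v : XVar n} (h : v ∈ M) :
    HasEdge M v.i v.j v.p v.q :=
  ⟨v, h, Or.inl ⟨rfl, rfl, rfl, rfl⟩⟩

theorem halfCount_cons (v : XVar n) (M : Multiset (XVar n)) (i : Fin n) (p : ℤˣ) :
    halfCount (v ::ₘ M) i p = halfCount M i p +
      ((if v.i = i ∧ v.p = p then 1 else 0) + if v.j = i ∧ v.q = p then 1 else 0) := by
  have := v.lt.ne
  rw [halfCount, halfCount, Multiset.countP_cons]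
  grind

theorem halfCount_cons_add (v : XVar n) (M : Multiset (XVar n)) (i : Fin n) :
    halfCount (v ::ₘ M) i 1 + halfCount (v ::ₘ M) i (-1) = halfCount M i 1 + halfCount M i (-1) +
      ((if i = v.i then 1 else 0) + if i = v.j then 1 else 0) := by
  simp only [halfCount_cons]
  rcases Int.units_eq_one_or v.p with h | h <;> rcases Int.units_eq_one_or v.q with h' | h' <;>
    simp [h, h', eq_comm] <;> omega

theorem weight_apply (M : Multiset (XVar n)) (i : Fin n) :
    weight M i = (halfCount M i 1 : ℤ) - halfCount M i (-1) := by
  induction M using Multiset.induction_on with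
  | empty => simp [weight, halfCount]
  | cons v M ih =>
    have : weight (v ::ₘ M) i = (Pi.single v.i (v.p : ℤ) : Fin n → ℤ) i +
        (Pi.single v.j (v.q : ℤ) : Fin n → ℤ) i + weight M i := by
      simp [weight]
    rw [this, ih, halfCount_cons, halfCount_cons]
    simp only [Pi.single_apply, eq_comm (a := i)]
    rcases Int.units_eq_one_or v.p with h | h <;> rcases Int.units_eq_one_or v.q with h' | h' <;>
      simp [h, h'] <;> split_ifs <;> omega

theorem halfCount_add_le_card (M : Multiset (XVar n)) (i : Fin n) :
    halfCount M i 1 + halfCount M i (-1) ≤ M.card := by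
  induction M using Multiset.induction_on with
  | empty => simp [halfCount]
  | cons v M ih =>
    have := v.lt.ne
    rw [halfCount_cons_add, Multiset.card_cons]
    split_ifs <;> grind

theorem sum_halfCount (M : Multiset (XVar n)) :
    ∑ i, (halfCount M i 1 + halfCount M i (-1)) = 2 * M.card := by
  induction M using Multiset.induction_on with
  | empty => simp [halfCount]
  | cons v M ih =>
    simp only [halfCount_cons_add, Finset.sum_add_distrib, Multiset.card_cons] at ih ⊢
    simp
    omega

theorem halfCount_pos {M : Multiset (XVar n)} {i : Fin n} {p : ℤˣ} (h : halfCount M i p ≠ 0) :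
    ∃ j q, HasEdge M i j p q := by
  obtain ⟨v, hv, h⟩ := Multiset.countP_pos.1 (Nat.pos_of_ne_zero h)
  rcases h with ⟨rfl, rfl⟩ | ⟨rfl, rfl⟩
  · exact ⟨_, _, hasEdge_of_mem hv⟩
  · exact ⟨_, _, (hasEdge_of_mem hv).symm⟩

theorem HasEdge.halfCount_ne_zero {M : Multiset (XVar n)} {i j : Fin n} {p q : ℤˣ}
    (h : HasEdge M i j p q) : halfCount M i p ≠ 0 := by
  obtain ⟨v, hv, h⟩ := h
  exact (Multiset.countP_pos_of_mem hv (by grind)).ne'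

/-- The weight and the degree of a vertex determine how often each sign occurs at it. -/
theorem halfCount_congr {M N : Multiset (XVar n)} (hw : weight M = weight N) {i : Fin n}
    (h : halfCount M i 1 + halfCount M i (-1) = halfCount N i 1 + halfCount N i (-1)) (p : ℤˣ) :
    halfCount M i p = halfCount N i p := by
  have h1 := congrFun hw i
  rw [weight_apply, weight_apply] at h1
  rcases Int.units_eq_one_or p with rfl | rfl <;> omega

/-! ### Stars -/

/-- All signs at the vertex `i` agree. -/
def IsPure (M : Multiset (XVar n)) (i : Fin n) : Prop :=
  halfCount M i 1 = 0 ∨ halfCount M i (-1) = 0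

theorem IsPure.halfCount_add {M : Multiset (XVar n)} {i : Fin n} (h : IsPure M i) :
    halfCount M i 1 + halfCount M i (-1) = (weight M i).natAbs := by
  rw [weight_apply]
  rcases h with h | h <;> omega

theorem natAbs_weight_le (M : Multiset (XVar n)) (i : Fin n) :
    (weight M i).natAbs ≤ halfCount M i 1 + halfCount M i (-1) := by
  rw [weight_apply]
  omega

/-- `M` is a star: all edges have the half-edge `(c, p)`, and the only vertex with both signs
is `w`, where `w` is the first vertex, unless this is the center `c` and `w` is the last vertex. -/
structure IsStar (M : Multiset (XVar n)) (c w : Fin n) (p : ℤˣ) : Prop where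
  vertices : (w.val = 0 ∧ c ≠ w) ∨ (c.val = 0 ∧ w.val + 1 = n ∧ c ≠ w)
  center : ∀ v ∈ M, (v.i = c ∧ v.p = p) ∨ (v.j = c ∧ v.q = p)
  pure : ∀ j, j ≠ w → IsPure M j
  not_pure : ¬ IsPure M w

theorem neg_units_ne (q : ℤˣ) : -q ≠ q := by
  rcases Int.units_eq_one_or q with rfl | rfl <;> decide

theorem eq_neg_of_units_ne {p q : ℤˣ} (h : p ≠ q) : p = -q := by
  rcases Int.units_eq_one_or p with rfl | rfl <;> rcases Int.units_eq_one_or q with rfl | rfl <;>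
    simp_all

namespace IsStandard

variable {M : Multiset (XVar n)}

/-- Edges with opposite signs at a common vertex end in the same half-edge. -/
theorem eq_of_signs (hM : IsStandard M) {i j k : Fin n} {p q r : ℤˣ}
    (h : HasEdge M i j p q) (h' : HasEdge M i k (-p) r) : j = k ∧ q = r := by
  have hjk : j = k := by
    by_contra hjk
    rcases Int.units_eq_one_or p with rfl | rfl
    · exact hM.not_opposite_at i j k q r h.ne h'.ne hjk h h'
    · rw [neg_neg] at h'
      exact hM.not_opposite_at i k j r q h'.ne h.ne (Ne.symm hjk) h' h
  subst hjk
  refine ⟨rfl, ?_⟩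
  by_contra hqr
  refine hM.not_opposite i j p q h ?_
  rwa [← eq_neg_of_units_ne (Ne.symm hqr)]

/-- A vertex with both signs is joined by its edges to only one half-edge. -/
theorem exists_of_not_isPure (hM : IsStandard M) {w : Fin n} (hw : ¬ IsPure M w) :
    ∃ c p, HasEdge M c w p 1 ∧ HasEdge M c w p (-1) := by
  simp only [IsPure, not_or] at hw
  obtain ⟨j, q, h⟩ := halfCount_pos hw.1
  obtain ⟨k, r, h'⟩ := halfCount_pos hw.2
  obtain ⟨rfl, rfl⟩ := hM.eq_of_signs h h'
  exact ⟨j, q, h.symm, h'.symm⟩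

theorem vertices_of_square (hM : IsStandard M) {c w : Fin n} {p : ℤˣ}
    (h : HasEdge M c w p 1) (h' : HasEdge M c w p (-1)) :
    (w.val = 0 ∧ c ≠ w) ∨ (c.val = 0 ∧ w.val + 1 = n ∧ c ≠ w) := by
  have hne := h.ne
  by_cases hw : w.val = 0
  · exact Or.inl ⟨hw, hne⟩
  have hn : 0 < n := by have := w.isLt; omega
  refine Or.inr ?_
  have hc : c.val = 0 := by
    by_contra hc
    exact hM.not_square ⟨0, hn⟩ c w p rfl (Fin.lt_def.2 (by simp; omega))
      (Fin.lt_def.2 (by simp; omega)) hne h h'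
  refine ⟨hc, ?_, hne⟩
  by_contra he
  have := w.isLt
  exact hM.not_square_first c ⟨n - 1, by omega⟩ w p hc (by simp; omega)
    (Fin.lt_def.2 (by omega)) (Fin.lt_def.2 (by simp; omega)) h h'

theorem isStar (hM : IsStandard M) {w : Fin n} (hw : ¬ IsPure M w) :
    ∃ c p, IsStar M c w p := by
  obtain ⟨c, p, h, h'⟩ := hM.exists_of_not_isPure hw
  have hv := hM.vertices_of_square h h'
  have hne := h.ne
  -- both signs occur at `w`, so every edge at `w` ends in the half-edge `(c, p)`
  have hW : ∀ k q r, HasEdge M w k q r → k = c ∧ r = p := by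
    intro k q r hk
    rcases Int.units_eq_one_or q with rfl | rfl
    · exact hM.eq_of_signs hk h'.symm
    · exact hM.eq_of_signs hk (by simpa using h.symm)
  -- an edge at `c` with sign `-p` would end in both half-edges `(w, 1)` and `(w, -1)`
  have hC : ∀ k q r, HasEdge M c k q r → q = p := by
    intro k q r hk
    by_contra hq
    obtain rfl := eq_neg_of_units_ne hq
    have h1 := (hM.eq_of_signs h hk).2
    have h2 := (hM.eq_of_signs h' hk).2
    exact neg_units_ne 1 (h2.trans h1.symm)
  -- an edge that avoids `c` also avoids `w`; next to the two edges from `c` to `w` it is excluded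
  -- by the cubic binomials if `w` is the first vertex, and as a nested edge otherwise
  have hcenter : ∀ j k q r, HasEdge M j k q r → j = c ∨ k = c := by
    intro j k q r hjk
    by_contra hcon
    obtain ⟨hj, hk⟩ := not_or.1 hcon
    have hjw : j ≠ w := by
      rintro rfl
      exact hk (hW _ _ _ hjk).1
    have hkw : k ≠ w := by
      rintro rfl
      exact hj (hW _ _ _ hjk.symm).1
    have hjk' := hjk.ne
    rcases hv with ⟨hv, -⟩ | ⟨hv, hv', -⟩
    · have pos : ∀ x : Fin n, x ≠ w → w < x := fun x hx => by
        refine Fin.lt_def.2 ?_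
        have := Fin.val_ne_of_ne hx
        omega
      exact hM.not_square_mul w c j k p q r hv (pos c hne) (pos j hjw) (pos k hkw) (Ne.symm hj)
        (Ne.symm hk) hjk' h.symm h'.symm hjk
    · have pos : ∀ x : Fin n, x ≠ c → x ≠ w → c < x ∧ x < w := fun x hx hx' => by
        simp only [Fin.lt_def]
        have := Fin.val_ne_of_ne hx
        have := Fin.val_ne_of_ne hx'
        have := x.isLt
        omega
      rcases lt_or_gt_of_ne hjk' with hlt | hlt
      · exact hM.not_nested c j k w p q r 1 (pos j hj hjw).1 hlt (pos k hk hkw).2 h hjk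
      · exact hM.not_nested c k j w p r q 1 (pos k hk hkw).1 hlt (pos j hj hjw).2 h hjk.symm
  refine ⟨c, p, hv, ?_, ?_, hw⟩
  · intro v hvM
    have hE := hasEdge_of_mem hvM
    rcases hcenter _ _ _ _ hE with hc | hc
    · exact Or.inl ⟨hc, by rw [hc] at hE; exact hC _ _ _ hE⟩
    · exact Or.inr ⟨hc, by rw [hc] at hE; exact hC _ _ _ hE.symm⟩
  · intro j hj
    by_contra hjp
    obtain ⟨d, q, h1, h2⟩ := hM.exists_of_not_isPure hjp
    have hv' := hM.vertices_of_square h1 h2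
    have hj' := Fin.val_ne_of_ne hj
    rcases hcenter _ _ _ _ h1 with hd | hd
    · subst hd
      rcases hv with ⟨hv, -⟩ | ⟨hv, hv1, -⟩ <;> rcases hv' with ⟨hv2, hv3⟩ | ⟨hv2, hv3, hv4⟩
      · omega
      · exact hne (Fin.ext (by omega))
      · exact hv3 (Fin.ext (by omega))
      · omega
    · subst hd
      have h3 := hC _ _ _ h1.symm
      have h4 := hC _ _ _ h2.symm
      exact neg_units_ne 1 (h4.trans h3.symm)

end IsStandard

namespace IsStar

variable {M : Multiset (XVar n)} {c w : Fin n} {p : ℤˣ}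

theorem halfCount_center (h : IsStar M c w p) : halfCount M c p = M.card :=
  Multiset.countP_eq_card.2 h.center

theorem card_pos (h : IsStar M c w p) : 0 < M.card := by
  have h1 := h.not_pure
  have h2 := halfCount_add_le_card M w
  simp only [IsPure, not_or] at h1
  omega

theorem halfCount_center_neg (h : IsStar M c w p) : halfCount M c (-p) = 0 := by
  have h1 := h.halfCount_center
  have h2 := halfCount_add_le_card M c
  rcases Int.units_eq_one_or p with rfl | rfl
  · omega
  · rw [neg_neg]
    omega

theorem weight_center (h : IsStar M c w p) : weight M c = p * M.card := by
  have h1 := h.halfCount_center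
  have h2 := h.halfCount_center_neg
  rw [weight_apply]
  rcases Int.units_eq_one_or p with rfl | rfl
  · simp [h1, h2]
  · rw [neg_neg] at h2
    simp [h1, h2]

theorem natAbs_weight_center (h : IsStar M c w p) : (weight M c).natAbs = M.card := by
  rw [h.weight_center, Int.natAbs_mul, Int.units_natAbs]
  simp

/-- The center of a star outweighs all other vertices together. The inequality is strict because
both signs occur at `w` and cancel there. -/
theorem sum_lt (h : IsStar M c w p) :
    ∑ j, (weight M j).natAbs < 2 * (weight M c).natAbs := by
  rw [h.natAbs_weight_center, ← sum_halfCount]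
  refine Finset.sum_lt_sum (fun j _ => natAbs_weight_le M j) ⟨w, Finset.mem_univ _, ?_⟩
  have h1 := h.not_pure
  simp only [IsPure, not_or] at h1
  rw [weight_apply]
  omega

end IsStar

theorem eq_of_sum_lt {f : Fin n → ℕ} {c d : Fin n} (hc : ∑ j, f j < 2 * f c)
    (hd : ∑ j, f j < 2 * f d) : c = d := by
  by_contra hne
  have : ∑ j ∈ {c, d}, f j ≤ ∑ j, f j :=
    Finset.sum_le_sum_of_subset (Finset.subset_univ _)
  rw [Finset.sum_pair hne] at this
  omega

/-- In a star the multiplicity of an edge is the multiplicity of its outer half-edge. -/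
theorem IsStar.count_eq [DecidableEq (XVar n)] {M : Multiset (XVar n)} {c w : Fin n} {p : ℤˣ}
    (h : IsStar M c w p) (v : XVar n) :
    M.count v = if v.i = c ∧ v.p = p then halfCount M v.j v.q
      else if v.j = c ∧ v.q = p then halfCount M v.i v.p else 0 := by
  have hv := v.lt
  split_ifs with h1 h2
  · refine Multiset.countP_congr rfl fun u hu => ?_
    have := h.center u hu
    have := u.lt
    rw [XVar.ext_iff, eq_iff_iff]
    grind
  · refine Multiset.countP_congr rfl fun u hu => ?_
    have := h.center u hu
    have := u.lt
    rw [XVar.ext_iff, eq_iff_iff]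
    grind
  · exact Multiset.count_eq_zero.2 fun hv => (h.center v hv).elim h1 h2

theorem IsStar.eq_of_weight_eq {M N : Multiset (XVar n)} {c w c' w' : Fin n} {p p' : ℤˣ}
    (hM : IsStar M c w p) (hN : IsStar N c' w' p') (hw : weight M = weight N) : M = N := by
  classical
  obtain rfl : c = c' := eq_of_sum_lt hM.sum_lt (by rw [hw]; exact hN.sum_lt)
  have hcard : M.card = N.card := by
    rw [← hM.natAbs_weight_center, hw, hN.natAbs_weight_center]
  obtain rfl : p = p' := by
    have h1 := hM.weight_center
    rw [hw, hN.weight_center, ← hcard] at h1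
    have h2 := hM.card_pos
    exact Units.ext (mul_right_cancel₀ (by exact_mod_cast h2.ne') h1.symm)
  obtain rfl : w = w' := by
    have h1 := hM.vertices
    have h2 := hN.vertices
    refine Fin.ext ?_
    rcases h1 with ⟨h1, h1'⟩ | ⟨h1, h1', -⟩ <;> rcases h2 with ⟨h2, h2'⟩ | ⟨h2, h2', -⟩
    · omega
    · exact absurd (Fin.ext (by omega)) h1'
    · exact absurd (Fin.ext (by omega)) h2'
    · omega
  have hdeg : ∀ j, j ≠ w → halfCount M j 1 + halfCount M j (-1) =
      halfCount N j 1 + halfCount N j (-1) := fun j hj => by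
    rw [(hM.pure j hj).halfCount_add, (hN.pure j hj).halfCount_add, hw]
  have hdeg' : halfCount M w 1 + halfCount M w (-1) = halfCount N w 1 + halfCount N w (-1) := by
    have h1 := sum_halfCount M
    rw [hcard, ← sum_halfCount N, ← Finset.add_sum_erase _ _ (Finset.mem_univ w),
      ← Finset.add_sum_erase _ _ (Finset.mem_univ w),
      Finset.sum_congr rfl fun j hj => hdeg j (Finset.ne_of_mem_erase hj)] at h1
    exact Nat.add_right_cancel h1
  have hcount : ∀ j q, halfCount M j q = halfCount N j q := fun j q => by
    refine halfCount_congr hw ?_ q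
    by_cases hj : j = w
    · rw [hj, hdeg']
    · exact hdeg j hj
  refine Multiset.ext.2 fun v => ?_
  rw [hM.count_eq, hN.count_eq, hcount, hcount]

/-! ### Pure multigraphs and uniqueness -/

/-- A multiset of pairs in which any two pairs are comparable in the product order, and every
first component is at most every second component, is determined by the multiset of all
components: listed increasingly, the first components followed by the second components are the
sorted list of all components. -/
theorem eq_of_map_fst_add_map_snd_eq {α : Type*} [LinearOrder α] {P Q : Multiset (α × α)}
    (hP : ∀ a ∈ P, ∀ b ∈ P, a.1 ≤ b.2 ∧ (a ≤ b ∨ b ≤ a))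
    (hQ : ∀ a ∈ Q, ∀ b ∈ Q, a.1 ≤ b.2 ∧ (a ≤ b ∨ b ≤ a))
    (h : P.map Prod.fst + P.map Prod.snd = Q.map Prod.fst + Q.map Prod.snd) : P = Q := by
  have key : ∀ P : Multiset (α × α), (∀ a ∈ P, ∀ b ∈ P, a.1 ≤ b.2 ∧ (a ≤ b ∨ b ≤ a)) →
      ∃ l : List (α × α), (l : Multiset (α × α)) = P ∧
        (l.map Prod.fst ++ l.map Prod.snd).Pairwise (· ≤ ·) := by
    intro P hP
    have hsort := (P.map toLex).pairwise_sort (· ≤ ·)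
    have hcoe : (((P.map toLex).sort (· ≤ ·)).map ofLex : Multiset (α × α)) = P := by
      rw [← Multiset.map_coe, Multiset.sort_eq, Multiset.map_map]
      exact Multiset.map_id _
    set s := (P.map toLex).sort (· ≤ ·)
    have hmem : ∀ a ∈ s, ofLex a ∈ P := fun a ha => by
      rw [← hcoe]
      exact List.mem_map_of_mem ha
    have hmono : s.Pairwise fun a b => ofLex a ≤ ofLex b := by
      refine hsort.imp_of_mem fun {a b} ha hb hab => ?_
      refine (hP _ (hmem a ha) _ (hmem b hb)).2.elim id fun hba => ?_
      have : b ≤ a := Prod.Lex.toLex_mono hba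
      rw [le_antisymm hab this]
    refine ⟨s.map ofLex, hcoe, List.pairwise_append.2 ⟨?_, ?_, ?_⟩⟩
    · rw [List.map_map, List.pairwise_map]
      exact hmono.imp fun h => h.1
    · rw [List.map_map, List.pairwise_map]
      exact hmono.imp fun h => h.2
    · intro x hx y hy
      simp only [List.map_map, List.mem_map, Function.comp_apply] at hx hy
      obtain ⟨a, ha, rfl⟩ := hx
      obtain ⟨b, hb, rfl⟩ := hy
      exact (hP _ (hmem a ha) _ (hmem b hb)).1
  obtain ⟨l, rfl, hl⟩ := key P hP
  obtain ⟨l', rfl, hl'⟩ := key Q hQ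
  have hperm : (l.map Prod.fst ++ l.map Prod.snd).Perm (l'.map Prod.fst ++ l'.map Prod.snd) := by
    simpa only [Multiset.map_coe, Multiset.coe_add, Multiset.coe_eq_coe] using h
  have hlen : l.length = l'.length := by
    have := hperm.length_eq
    simp only [List.length_append, List.length_map] at this
    omega
  have := hperm.eq_of_pairwise' hl hl'
  obtain ⟨h1, h2⟩ := List.append_inj this (by simpa using hlen)
  congr 1
  rw [List.zip_of_prod h1 h2, ← List.zip_of_prod rfl rfl]

theorem count_map_fst_add_map_snd (M : Multiset (XVar n)) (i : Fin n) :
    ((M.map fun v => (v.i, v.j)).map Prod.fst + (M.map fun v => (v.i, v.j)).map Prod.snd).count i =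
      halfCount M i 1 + halfCount M i (-1) := by
  induction M using Multiset.induction_on with
  | empty => simp [halfCount]
  | cons v M ih =>
    rw [halfCount_cons_add, ← ih]
    simp only [Multiset.map_map, Function.comp_def, Multiset.map_cons, Multiset.count_add,
      Multiset.count_cons]
    omega

/-- In a standard multigraph any two edges share a vertex or cross, when the vertices are placed
on a circle. -/
theorem IsStandard.le_and_comparable {M : Multiset (XVar n)} (hM : IsStandard M) {u v : XVar n}
    (hu : u ∈ M) (hv : v ∈ M) :
    u.i ≤ v.j ∧ ((u.i, u.j) ≤ (v.i, v.j) ∨ (v.i, v.j) ≤ (u.i, u.j)) := by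
  have hU := hasEdge_of_mem hu
  have hV := hasEdge_of_mem hv
  refine ⟨?_, ?_⟩
  · by_contra! h
    exact hM.not_separated _ _ _ _ _ _ _ _ v.lt h u.lt hV hU
  · simp only [Prod.mk_le_mk]
    by_contra! h
    rcases lt_trichotomy u.i v.i with h1 | h1 | h1
    · exact hM.not_nested _ _ _ _ _ _ _ _ h1 v.lt (h.1 h1.le) hU hV
    · exact absurd (h.1 h1.le) (h.2 h1.ge).not_gt
    · exact hM.not_nested _ _ _ _ _ _ _ _ h1 u.lt (h.2 h1.le) hV hU

/-- If all vertices are pure, the vertices of an edge determine its signs. -/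
theorem count_eq_of_isPure [DecidableEq (XVar n)] {M : Multiset (XVar n)} (h : ∀ i, IsPure M i)
    (v : XVar n) : M.count v = if halfCount M v.i v.p = 0 ∨ halfCount M v.j v.q = 0 then 0
      else (M.map fun u => (u.i, u.j)).count (v.i, v.j) := by
  have hsign : ∀ i p q, halfCount M i p ≠ 0 → halfCount M i q ≠ 0 → p = q := by
    intro i p q hp hq
    by_contra hpq
    have := h i
    rcases Int.units_eq_one_or p with rfl | rfl <;> rcases Int.units_eq_one_or q with rfl | rfl <;>
      simp_all [IsPure]
  split_ifs with hv
  · refine Multiset.count_eq_zero.2 fun hvM => ?_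
    have hE := hasEdge_of_mem hvM
    exact hv.elim hE.halfCount_ne_zero hE.symm.halfCount_ne_zero
  · rw [not_or] at hv
    rw [Multiset.count, Multiset.count, Multiset.countP_map, ← Multiset.countP_eq_card_filter]
    refine Multiset.countP_congr rfl fun u hu => ?_
    have hE := hasEdge_of_mem hu
    rw [XVar.ext_iff, Prod.mk.injEq, eq_iff_iff]
    refine ⟨fun h => ⟨h.1, h.2.1⟩, fun h => ⟨h.1, h.2, ?_, ?_⟩⟩
    · exact hsign _ _ _ hv.1 (h.1 ▸ hE.halfCount_ne_zero)
    · exact hsign _ _ _ hv.2 (h.2 ▸ hE.symm.halfCount_ne_zero)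

theorem IsStandard.eq_of_isPure {M N : Multiset (XVar n)} (hM : IsStandard M) (hN : IsStandard N)
    (hM' : ∀ i, IsPure M i) (hN' : ∀ i, IsPure N i) (hw : weight M = weight N) : M = N := by
  classical
  have hdeg : ∀ i, halfCount M i 1 + halfCount M i (-1) = halfCount N i 1 + halfCount N i (-1) :=
    fun i => by rw [(hM' i).halfCount_add, (hN' i).halfCount_add, hw]
  have hpairs : (M.map fun v => (v.i, v.j)) = N.map fun v => (v.i, v.j) := by
    refine eq_of_map_fst_add_map_snd_eq ?_ ?_ ?_
    · simp only [Multiset.mem_map]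
      rintro _ ⟨u, hu, rfl⟩ _ ⟨v, hv, rfl⟩
      exact hM.le_and_comparable hu hv
    · simp only [Multiset.mem_map]
      rintro _ ⟨u, hu, rfl⟩ _ ⟨v, hv, rfl⟩
      exact hN.le_and_comparable hu hv
    · refine Multiset.ext.2 fun i => ?_
      rw [count_map_fst_add_map_snd, count_map_fst_add_map_snd, hdeg]
  refine Multiset.ext.2 fun v => ?_
  rw [count_eq_of_isPure hM', count_eq_of_isPure hN', hpairs, halfCount_congr hw (hdeg _),
    halfCount_congr hw (hdeg _)]

/-- If all vertices are pure, no vertex outweighs all other vertices together. -/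
theorem two_mul_natAbs_weight_le {M : Multiset (XVar n)} (h : ∀ i, IsPure M i) (i : Fin n) :
    2 * (weight M i).natAbs ≤ ∑ j, (weight M j).natAbs := by
  rw [← Finset.sum_congr rfl fun j _ => (h j).halfCount_add, sum_halfCount]
  have := natAbs_weight_le M i
  have := halfCount_add_le_card M i
  omega

theorem IsStandard.eq_of_weight_eq {M N : Multiset (XVar n)} (hM : IsStandard M)
    (hN : IsStandard N) (hw : weight M = weight N) : M = N := by
  by_cases hM' : ∀ i, IsPure M i <;> by_cases hN' : ∀ i, IsPure N i
  · exact hM.eq_of_isPure hN hM' hN' hw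
  · obtain ⟨w, hNw⟩ := not_forall.1 hN'
    obtain ⟨c, p, hs⟩ := hN.isStar hNw
    exact absurd (two_mul_natAbs_weight_le hM' c) (by rw [hw]; exact hs.sum_lt.not_ge)
  · obtain ⟨w, hMw⟩ := not_forall.1 hM'
    obtain ⟨c, p, hs⟩ := hM.isStar hMw
    exact absurd (two_mul_natAbs_weight_le hN' c) (by rw [← hw]; exact hs.sum_lt.not_ge)
  · obtain ⟨w, hMw⟩ := not_forall.1 hM'
    obtain ⟨c, p, hs⟩ := hM.isStar hMw
    obtain ⟨w', hNw⟩ := not_forall.1 hN'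
    obtain ⟨c', p', hs'⟩ := hN.isStar hNw
    exact hs.eq_of_weight_eq hs' hw

/-! ### A criterion for Gröbner bases -/

open MvPolynomial in
/-- If no nonzero element of the ideal `I` is reduced modulo `G`, then `G` is a Gröbner basis
of `I`. -/
theorem isGroebnerBasis_of_reduced_eq_zero {σ K : Type*} [Field K] (m : MonomialOrder σ)
    (I : Ideal (MvPolynomial σ K)) (G : Set (MvPolynomial σ K)) (hfin : G.Finite)
    (h0 : (0 : MvPolynomial σ K) ∉ G) (hG : G ⊆ I)
    (hred : ∀ r ∈ I, (∀ c ∈ r.support, ∀ g ∈ G, ¬ m.degree g ≤ c) → r = 0) :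
    IsGroebnerBasis m I G := by
  refine ⟨hfin, h0, hG, le_antisymm (Ideal.span_mono (Set.image_mono hG)) ?_⟩
  rw [Ideal.span_le]
  rintro _ ⟨f, hf, rfl⟩
  by_cases hf0 : f = 0
  · simp [hf0]
  have hne : ∀ g ∈ G, g ≠ 0 := fun g hg h => h0 (h ▸ hg)
  obtain ⟨q, r, hfq, hdeg, hr⟩ := m.div_set (B := G)
    (fun g hg => (m.leadingCoeff_ne_zero_iff.2 (hne g hg)).isUnit) f
  have hqI : Finsupp.linearCombination _ (fun b : G => (b : MvPolynomial σ K)) q ∈ I := by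
    rw [Finsupp.linearCombination_apply]
    exact Submodule.sum_mem _ fun b _ => I.mul_mem_left _ (hG b.2)
  have hr0 : r = 0 := hred r (by rw [eq_sub_of_add_eq' hfq.symm]; exact I.sub_mem hf hqI) hr
  rw [hr0, add_zero, Finsupp.linearCombination_apply, Finsupp.sum] at hfq
  -- the leading monomial of `f` occurs in one of the summands of the division
  have hcoeff : coeff (m.degree f) f ≠ 0 := m.leadingCoeff_ne_zero_iff.2 hf0
  conv at hcoeff => enter [1, 2]; rw [hfq]
  rw [coeff_sum] at hcoeff
  obtain ⟨b, -, hb⟩ := Finset.exists_ne_zero_of_sum_ne_zero hcoeff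
  rw [smul_eq_mul, mul_comm] at hb
  have hd : m.degree ((b : MvPolynomial σ K) * q b) = m.degree f :=
    m.toSyn.injective (le_antisymm (hdeg b) (m.le_degree (mem_support_iff.2 hb)))
  have hq0 : q b ≠ 0 := by
    rintro h
    simp [h] at hb
  rw [m.degree_mul (hne b b.2) hq0] at hd
  have hb0 : m.leadingCoeff (b : MvPolynomial σ K) ≠ 0 := m.leadingCoeff_ne_zero_iff.2 (hne b b.2)
  have : m.leadingTerm f = monomial (m.degree (q b))
      (m.leadingCoeff f / m.leadingCoeff (b : MvPolynomial σ K)) * m.leadingTerm b := by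
    rw [MonomialOrder.leadingTerm, MonomialOrder.leadingTerm, monomial_mul, ← hd,
      add_comm, div_mul_cancel₀ _ hb0]
  rw [this]
  exact Ideal.mul_mem_left _ _ (Ideal.subset_span ⟨b, b.2, rfl⟩)

/-! ### The image of a monomial -/

/-- The exponent of the image of a monomial under `π`. -/
noncomputable def exponent : (DVar n →₀ ℕ) →+ (Fin n → ℤ) × ℕ :=
  Finsupp.liftAddHom fun a => multiplesHom _ (varExponent a)

theorem exponent_single (a : DVar n) : exponent (Finsupp.single a 1) = varExponent a := by
  simp [exponent]

theorem weight_add (M N : Multiset (XVar n)) : weight (M + N) = weight M + weight N := by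
  simp [weight]

theorem exponent_apply (u : DVar n →₀ ℕ) :
    exponent u = (weight (Finsupp.toMultiset u.some), u.some.degree + u none) := by
  induction u using Finsupp.induction_linear with
  | zero =>
    simp [weight]
    rfl
  | add u v hu hv =>
    rw [map_add, hu, hv, Finsupp.some_add, map_add, map_add, weight_add, Finsupp.add_apply,
      Prod.mk_add_mk, add_add_add_comm]
  | single a k =>
    cases a with
    | none => simp [exponent, varExponent, weight]
    | some a =>
      simp [exponent, varExponent, weight, Finsupp.some_single_some, Finsupp.degree_single,
        Multiset.map_nsmul, Multiset.sum_nsmul]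

theorem toricMap_monomial (K : Type*) [Field K] (u : DVar n →₀ ℕ) (c : K) :
    toricMap K n (MvPolynomial.monomial u c) = AddMonoidAlgebra.single (exponent u) c := by
  rw [toricMap, MvPolynomial.aeval_monomial]
  simp only [AddMonoidAlgebra.single_pow, one_pow, Finsupp.prod, AddMonoidAlgebra.prod_single,
    Finset.prod_const_one]
  rw [AddMonoidAlgebra.coe_algebraMap]
  simp [AddMonoidAlgebra.single_mul_single, exponent, Finsupp.liftAddHom_apply, Finsupp.sum]

/-- A polynomial in the kernel of `π` vanishes if its monomials have different images. -/
theorem eq_zero_of_mem_toricIdeal (K : Type*) [Field K] {f : MvPolynomial (DVar n) K}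
    (hf : f ∈ toricIdeal K n) (hinj : Set.InjOn (exponent (n := n)) f.support) : f = 0 := by
  classical
  by_contra hf0
  obtain ⟨u, hu⟩ := MvPolynomial.support_nonempty.2 hf0
  have h : (toricMap K n f).coeff (exponent u) = 0 := by
    rw [show toricMap K n f = 0 from hf]
    simp
  rw [f.as_sum, map_sum] at h
  simp only [toricMap_monomial, AddMonoidAlgebra.coeff_sum, AddMonoidAlgebra.coeff_single,
    Finsupp.finsetSum_apply, Finsupp.single_apply] at h
  rw [Finset.sum_eq_single_of_mem u hu] at h
  · rw [if_pos rfl] at h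
    exact MvPolynomial.mem_support_iff.1 hu h
  · intro v hv hvu
    exact if_neg fun h => hvu (hinj hv hu h)

open MvPolynomial

open scoped MonomialOrder

/-- `f` is a difference of monomials with the same image under `π`, and `u` is the exponent of its
initial monomial. -/
def IsMarked [LinearOrder (XVar n)] {K : Type*} [Field K] (f : MvPolynomial (DVar n) K)
    (u : DVar n →₀ ℕ) : Prop :=
  ∃ v, f = monomial u 1 - monomial v 1 ∧ v ≺[dOrder n] u ∧ exponent u = exponent v

section

variable [LinearOrder (XVar n)] {K : Type*} [Field K] {f : MvPolynomial (DVar n) K}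
  {u : DVar n →₀ ℕ}

theorem IsMarked.degree_eq (h : IsMarked f u) : (dOrder n).degree f = u := by
  classical
  obtain ⟨v, rfl, hlt, -⟩ := h
  rw [MonomialOrder.degree_sub_of_lt] <;> simp [MonomialOrder.degree_monomial, hlt]

theorem IsMarked.mem_toricIdeal (h : IsMarked f u) : f ∈ toricIdeal K n := by
  obtain ⟨v, rfl, -, he⟩ := h
  rw [toricIdeal, RingHom.mem_ker, map_sub, toricMap_monomial, toricMap_monomial, he, sub_self]

theorem IsMarked.ne_zero (h : IsMarked f u) : f ≠ 0 := by
  obtain ⟨v, rfl, hlt, -⟩ := h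
  rw [sub_ne_zero]
  intro he
  have : u = v := monomial_left_injective one_ne_zero he
  exact hlt.ne (by rw [this])

end

/-! ### Initial monomials of the binomials -/

/-- The variable `x_{ij}^{pq}`, where `x_{ij}^{pq}` means `x_{ji}^{qp}` for `j < i`. -/
def xvar {i j : Fin n} (h : i ≠ j) (p q : ℤˣ) : XVar n :=
  if h' : i < j then ⟨i, j, h', p, q⟩ else ⟨j, i, lt_of_le_of_ne (not_lt.1 h') h.symm, q, p⟩

theorem xvar_of_lt {i j : Fin n} (h : i < j) (p q : ℤˣ) : xvar h.ne p q = ⟨i, j, h, p, q⟩ :=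
  dif_pos h

theorem xPoly_eq (K : Type*) [Field K] {i j : Fin n} (h : i ≠ j) (p q : ℤˣ) :
    xPoly K i j p q = X (some (xvar h p q)) := by
  rw [xPoly, xvar]
  split_ifs with h1 h2
  · rfl
  · rfl
  · exact absurd (le_antisymm (not_lt.1 h2) (not_lt.1 h1)) h

theorem varExponent_none : varExponent (none : DVar n) = (0, 1) := rfl

theorem varExponent_xvar {i j : Fin n} (h : i ≠ j) (p q : ℤˣ) :
    varExponent (some (xvar h p q)) = (Pi.single i (p : ℤ) + Pi.single j (q : ℤ), 1) := by
  rw [xvar]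
  split_ifs
  · rfl
  · rw [add_comm]
    rfl

theorem HasEdge.xvar_mem {M : Multiset (XVar n)} {i j : Fin n} {p q : ℤˣ}
    (h : HasEdge M i j p q) : xvar h.ne p q ∈ M := by
  have hne := h.ne
  obtain ⟨v, hv, h | h⟩ := h
  · convert hv
    have := v.lt
    rw [xvar, dif_pos (by grind), XVar.ext_iff]
    grind
  · convert hv
    have := v.lt
    rw [xvar, dif_neg (by grind), XVar.ext_iff]
    grind

theorem X_mul_X (K : Type*) [Field K] (a b : DVar n) :
    (X a * X b : MvPolynomial (DVar n) K) =
      monomial (Finsupp.single a 1 + Finsupp.single b 1) 1 := by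
  rw [X, X, monomial_mul, one_mul]

theorem X_mul_X_mul_X (K : Type*) [Field K] (a b c : DVar n) :
    (X a * X b * X c : MvPolynomial (DVar n) K) =
      monomial (Finsupp.single a 1 + Finsupp.single b 1 + Finsupp.single c 1) 1 := by
  rw [X_mul_X, X, monomial_mul, one_mul]

section

variable [LinearOrder (XVar n)] (K : Type*) [Field K]

/-- A quadratic binomial in the variables `x` is marked by the product that contains the largest
variable. -/
theorem isMarked_lex {a b c d : XVar n} (hc : c < max a b) (hd : d < max a b)
    (he : varExponent (some a) + varExponent (some b) =
      varExponent (some c) + varExponent (some d)) :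
    IsMarked (X (some a) * X (some b) - X (some c) * X (some d) : MvPolynomial (DVar n) K)
      (Finsupp.single (some a) 1 + Finsupp.single (some b) 1) := by
  wlog hab : a ≤ b generalizing a b
  · rw [mul_comm, add_comm]
    exact this (max_comm a b ▸ hc) (max_comm a b ▸ hd) (by rw [add_comm, he]) (le_of_not_ge hab)
  rw [max_eq_right hab] at hc hd
  refine ⟨_, by rw [X_mul_X, X_mul_X], ?_, by simpa [exponent_single] using he⟩
  rw [dOrder_lt_iff]
  refine Or.inr (Or.inr ⟨?_, by simp, b, fun w hw => ?_, ?_⟩)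
  · simp [Finsupp.some_add, Finsupp.some_single_some, Finsupp.degree_single]
  · simp [hw.ne, (hc.trans hw).ne, (hd.trans hw).ne, (hab.trans_lt hw).ne]
  · simp [hc.ne, hd.ne]

/-- A quadratic binomial is marked by the product that does not contain `z`. -/
theorem isMarked_z {a b : XVar n} (c : DVar n)
    (he : varExponent (some a) + varExponent (some b) = varExponent c + varExponent none) :
    IsMarked (X (some a) * X (some b) - X c * X none : MvPolynomial (DVar n) K)
      (Finsupp.single (some a) 1 + Finsupp.single (some b) 1) := by
  refine ⟨_, by rw [X_mul_X, X_mul_X], ?_, by simpa [exponent_single] using he⟩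
  rw [dOrder_lt_iff]
  refine Or.inr (Or.inl ⟨?_, by simp⟩)
  cases c <;> simp [Finsupp.some_add, Finsupp.some_single_some, Finsupp.degree_single]

variable {K}

theorem isMarked_separated (hord : IsAdmissibleOrder (n := n)) {i j k l : Fin n} (p q r s : ℤˣ)
    (hij : i < j) (hjk : j < k) (hkl : k < l) :
    IsMarked (xPoly K i j p q * xPoly K k l r s - xPoly K i k p r * xPoly K j l q s)
      (Finsupp.single (some (xvar hij.ne p q)) 1 + Finsupp.single (some (xvar hkl.ne r s)) 1) := by
  have hik := hij.trans hjk
  have hjl := hjk.trans hkl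
  rw [xPoly_eq K hij.ne, xPoly_eq K hkl.ne, xPoly_eq K hik.ne, xPoly_eq K hjl.ne]
  refine isMarked_lex K (lt_max_of_lt_right ?_) (lt_max_of_lt_right ?_) ?_
  · rw [xvar_of_lt hik, xvar_of_lt hkl]
    exact hord _ _ (Or.inl hik)
  · rw [xvar_of_lt hjl, xvar_of_lt hkl]
    exact hord _ _ (Or.inl hjk)
  · simp only [varExponent_xvar, Prod.mk_add_mk, Prod.mk.injEq, and_true]
    abel

theorem isMarked_nested (hord : IsAdmissibleOrder (n := n)) {i j k l : Fin n} (p q r s : ℤˣ)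
    (hij : i < j) (hjk : j < k) (hkl : k < l) :
    IsMarked (xPoly K i l p s * xPoly K j k q r - xPoly K i k p r * xPoly K j l q s)
      (Finsupp.single (some (xvar (hij.trans (hjk.trans hkl)).ne p s)) 1 +
        Finsupp.single (some (xvar hjk.ne q r)) 1) := by
  have hik := hij.trans hjk
  have hjl := hjk.trans hkl
  rw [xPoly_eq K hjk.ne, xPoly_eq K (hik.trans hkl).ne, xPoly_eq K hik.ne, xPoly_eq K hjl.ne]
  refine isMarked_lex K (lt_max_of_lt_right ?_) (lt_max_of_lt_right ?_) ?_
  · rw [xvar_of_lt hik, xvar_of_lt hjk]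
    exact hord _ _ (Or.inl hij)
  · rw [xvar_of_lt hjl, xvar_of_lt hjk]
    exact hord _ _ (Or.inr ⟨rfl, hkl⟩)
  · simp only [varExponent_xvar, Prod.mk_add_mk, Prod.mk.injEq, and_true]
    abel

theorem isMarked_opposite_at {i j k : Fin n} (p q : ℤˣ) (hij : i ≠ j) (hik : i ≠ k)
    (hjk : j ≠ k) :
    IsMarked (xPoly K i j 1 p * xPoly K i k (-1) q - xPoly K j k p q * zPoly K n)
      (Finsupp.single (some (xvar hij 1 p)) 1 + Finsupp.single (some (xvar hik (-1) q)) 1) := by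
  rw [xPoly_eq K hij, xPoly_eq K hik, xPoly_eq K hjk]
  refine isMarked_z K _ ?_
  simp only [varExponent_xvar, varExponent_none, Prod.mk_add_mk, Prod.mk.injEq, and_true,
    Units.val_neg, Units.val_one, Pi.single_neg]
  abel

theorem isMarked_opposite {i j : Fin n} (p q : ℤˣ) (hij : i ≠ j) :
    IsMarked (xPoly K i j p q * xPoly K i j (-p) (-q) - zPoly K n ^ 2)
      (Finsupp.single (some (xvar hij p q)) 1 +
        Finsupp.single (some (xvar hij (-p) (-q))) 1) := by
  rw [xPoly_eq K hij, xPoly_eq K hij, sq]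
  refine isMarked_z K none ?_
  simp only [varExponent_xvar, varExponent_none, Prod.mk_add_mk, Prod.mk.injEq, and_true,
    Units.val_neg, Pi.single_neg]
  abel

theorem isMarked_square (hord : IsAdmissibleOrder (n := n)) {o i j : Fin n} (p : ℤˣ)
    (hi : o < i) (hj : o < j) (hij : i ≠ j) :
    IsMarked (xPoly K i j p 1 * xPoly K i j p (-1) - xPoly K o i 1 p * xPoly K o i (-1) p)
      (Finsupp.single (some (xvar hij p 1)) 1 + Finsupp.single (some (xvar hij p (-1))) 1) := by
  have hlt : ∀ q r s, xvar hi.ne q p < xvar hij r s := fun q r s => by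
    rw [xvar_of_lt hi, xvar]
    split_ifs
    · exact hord _ _ (Or.inl hi)
    · exact hord _ _ (Or.inl hj)
  rw [xPoly_eq K hij, xPoly_eq K hij, xPoly_eq K hi.ne, xPoly_eq K hi.ne]
  refine isMarked_lex K (lt_max_of_lt_left (hlt _ _ _)) (lt_max_of_lt_left (hlt _ _ _)) ?_
  simp only [varExponent_xvar, Prod.mk_add_mk, Prod.mk.injEq, and_true, Units.val_neg,
    Units.val_one, Pi.single_neg]
  abel

theorem isMarked_square_first (hord : IsAdmissibleOrder (n := n)) {o e j : Fin n} (p : ℤˣ)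
    (hj : o < j) (hje : j < e) :
    IsMarked (xPoly K o j p 1 * xPoly K o j p (-1) - xPoly K o e p 1 * xPoly K o e p (-1))
      (Finsupp.single (some (xvar hj.ne p 1)) 1 +
        Finsupp.single (some (xvar hj.ne p (-1))) 1) := by
  have hoe := hj.trans hje
  have hlt : ∀ q r, xvar hoe.ne p q < xvar hj.ne p r := fun q r => by
    rw [xvar_of_lt hoe, xvar_of_lt hj]
    exact hord _ _ (Or.inr ⟨rfl, hje⟩)
  rw [xPoly_eq K hj.ne, xPoly_eq K hj.ne, xPoly_eq K hoe.ne, xPoly_eq K hoe.ne]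
  refine isMarked_lex K (lt_max_of_lt_left (hlt _ _)) (lt_max_of_lt_left (hlt _ _)) ?_
  simp only [varExponent_xvar, Prod.mk_add_mk, Prod.mk.injEq, and_true, Units.val_neg,
    Units.val_one, Pi.single_neg]
  abel

theorem isMarked_square_mul {o i j k : Fin n} (p q r : ℤˣ) (hi : o ≠ i) (hij : i ≠ j)
    (hik : i ≠ k) (hjk : j ≠ k) :
    IsMarked (xPoly K o i 1 p * xPoly K o i (-1) p * xPoly K j k q r -
        xPoly K i j p q * xPoly K i k p r * zPoly K n)
      (Finsupp.single (some (xvar hi 1 p)) 1 + Finsupp.single (some (xvar hi (-1) p)) 1 +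
        Finsupp.single (some (xvar hjk q r)) 1) := by
  rw [xPoly_eq K hi, xPoly_eq K hi, xPoly_eq K hij, xPoly_eq K hik, xPoly_eq K hjk]
  refine ⟨_, by rw [X_mul_X_mul_X, zPoly, X_mul_X_mul_X], ?_, ?_⟩
  · rw [dOrder_lt_iff]
    refine Or.inr (Or.inl ⟨?_, by simp⟩)
    simp [Finsupp.some_add, Finsupp.some_single_some, Finsupp.degree_single]
  · simp only [map_add, exponent_single, varExponent_xvar, varExponent_none, Prod.mk_add_mk,
      Prod.mk.injEq, and_true, Units.val_neg, Units.val_one, Pi.single_neg]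
    abel

theorem IsDBinomial.exists_isMarked (hord : IsAdmissibleOrder (n := n))
    {f : MvPolynomial (DVar n) K} (h : IsDBinomial K f) : ∃ u, IsMarked f u := by
  cases h with
  | i i j k l p q r s hij hjk hkl => exact ⟨_, isMarked_separated hord p q r s hij hjk hkl⟩
  | ii i j k l p q r s hij hjk hkl => exact ⟨_, isMarked_nested hord p q r s hij hjk hkl⟩
  | iii i j k p q hij hik hjk => exact ⟨_, isMarked_opposite_at p q hij hik hjk⟩
  | iv i j hij => exact ⟨_, isMarked_opposite 1 1 hij.ne⟩
  | v i j hij => exact ⟨_, by simpa using isMarked_opposite (K := K) 1 (-1) hij.ne⟩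
  | vi o i j p ho hi hj hij => exact ⟨_, isMarked_square hord p hi hj hij⟩
  | vii o e j p ho he hj hj' => exact ⟨_, isMarked_square_first hord p hj hj'⟩
  | viii o i j k p q r ho hi hj hk hij hik hjk =>
    exact ⟨_, isMarked_square_mul p q r hi.ne hij hik hjk⟩

variable (K)

/-- A monomial that is divisible by none of the initial monomials of the binomials has a standard
multigraph. -/
theorem isStandard_of_not_le (hord : IsAdmissibleOrder (n := n)) {u : DVar n →₀ ℕ}
    (hu : ∀ g ∈ dBinomials K n, ¬ (dOrder n).degree g ≤ u) :
    IsStandard (Finsupp.toMultiset u.some) := by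
  have hpos : ∀ {v : XVar n}, v ∈ Finsupp.toMultiset u.some → 1 ≤ u (some v) := fun {v} hv => by
    rw [Finsupp.mem_toMultiset, Finsupp.mem_support_iff] at hv
    exact Nat.one_le_iff_ne_zero.2 hv
  have key : ∀ {f : MvPolynomial (DVar n) K} {a b : XVar n}, IsDBinomial K f →
      IsMarked f (Finsupp.single (some a) 1 + Finsupp.single (some b) 1) → a ≠ b →
      a ∈ Finsupp.toMultiset u.some → b ∈ Finsupp.toMultiset u.some → False := by
    intro f a b hf hm hab ha hb
    refine hu f hf ?_
    rw [hm.degree_eq]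
    intro v
    have ha := hpos ha
    have hb := hpos hb
    simp only [Finsupp.add_apply, Finsupp.single_apply]
    grind
  refine ⟨?_, ?_, ?_, ?_, ?_, ?_, ?_⟩
  · intro i j k l p q r s hij hjk hkl h h'
    refine key (.i i j k l p q r s hij hjk hkl) (isMarked_separated hord p q r s hij hjk hkl) ?_
      h.xvar_mem h'.xvar_mem
    rw [xvar_of_lt hij, xvar_of_lt hkl]
    grind
  · intro i j k l p q r s hij hjk hkl h h'
    refine key (.ii i j k l p q r s hij hjk hkl) (isMarked_nested hord p q r s hij hjk hkl) ?_
      h.xvar_mem h'.xvar_mem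
    rw [xvar_of_lt (hij.trans (hjk.trans hkl)), xvar_of_lt hjk]
    grind
  · intro i j k p q hij hik hjk h h'
    refine key (.iii i j k p q hij hik hjk) (isMarked_opposite_at p q hij hik hjk) ?_
      h.xvar_mem h'.xvar_mem
    rw [xvar, xvar]
    grind
  · intro i j p q h h'
    wlog hij : i < j generalizing i j p q
    · exact this j i q p h.symm h'.symm (lt_of_le_of_ne (not_lt.1 hij) h.ne.symm)
    have hne : xvar h.ne p q ≠ xvar h'.ne (-p) (-q) := by
      rw [xvar_of_lt hij, xvar_of_lt hij]
      have := neg_units_ne p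
      grind
    have hm := isMarked_opposite (K := K) p q hij.ne
    have hm' := isMarked_opposite (K := K) (-p) (-q) hij.ne
    have hiv := IsDBinomial.iv (K := K) i j hij
    have hv := IsDBinomial.v (K := K) i j hij
    rcases Int.units_eq_one_or p with rfl | rfl <;> rcases Int.units_eq_one_or q with rfl | rfl <;>
      simp only [neg_neg] at *
    · exact key hiv hm hne h.xvar_mem h'.xvar_mem
    · exact key hv hm hne h.xvar_mem h'.xvar_mem
    · exact key hv hm' hne.symm h'.xvar_mem h.xvar_mem
    · exact key hiv hm' hne.symm h'.xvar_mem h.xvar_mem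
  · intro o i j p ho hi hj hij h h'
    refine key (.vi o i j p ho hi hj hij) (isMarked_square hord p hi hj hij) ?_
      h.xvar_mem h'.xvar_mem
    rw [xvar, xvar]
    have := neg_units_ne 1
    grind
  · intro o e j p ho he hj hje h h'
    refine key (.vii o e j p ho he hj hje) (isMarked_square_first hord p hj hje) ?_
      h.xvar_mem h'.xvar_mem
    rw [xvar, xvar]
    have := neg_units_ne 1
    grind
  · intro o i j k p q r ho hi hj hk hij hik hjk h h' h''
    refine hu _ (.viii o i j k p q r ho hi hj hk hij hik hjk) ?_
    rw [(isMarked_square_mul p q r hi.ne hij hik hjk).degree_eq]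
    have h1 := hpos h.xvar_mem
    have h2 := hpos h'.xvar_mem
    have h3 := hpos h''.xvar_mem
    intro v
    simp only [Finsupp.add_apply, Finsupp.single_apply]
    have hne : xvar hi.ne 1 p ≠ xvar hi.ne (-1) p := by
      rw [xvar, xvar]
      have := neg_units_ne 1
      grind
    have hne1 : ∀ s, xvar hi.ne s p ≠ xvar hjk q r := fun s => by
      rw [xvar, xvar]
      grind
    grind

end

open scoped Pointwise in
theorem finite_dBinomials (K : Type*) [Field K] (n : ℕ) : (dBinomials K n).Finite := by
  let P : Set (MvPolynomial (DVar n) K) := insert (zPoly K n)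
    (Set.range fun t : Fin n × Fin n × ℤˣ × ℤˣ => xPoly K t.1 t.2.1 t.2.2.1 t.2.2.2)
  have hP : P.Finite := (Set.finite_range _).insert _
  have hz : zPoly K n ∈ P := Set.mem_insert _ _
  have hx : ∀ i j p q, xPoly K i j p q ∈ P := fun i j p q =>
    Set.mem_insert_of_mem _ ⟨(i, j, p, q), rfl⟩
  refine (((hP.mul hP).sub (hP.mul hP)).union
    (((hP.mul hP).mul hP).sub ((hP.mul hP).mul hP))).subset ?_
  rintro f (_ | _ | _ | _ | _ | _ | _ | _)
  case viii => exact Or.inr (Set.sub_mem_sub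
    (Set.mul_mem_mul (Set.mul_mem_mul (hx _ _ _ _) (hx _ _ _ _)) (hx _ _ _ _))
    (Set.mul_mem_mul (Set.mul_mem_mul (hx _ _ _ _) (hx _ _ _ _)) hz))
  all_goals
    refine Or.inl (Set.sub_mem_sub (Set.mul_mem_mul (hx _ _ _ _) (hx _ _ _ _)) ?_)
    first
      | exact Set.mul_mem_mul (hx _ _ _ _) (hx _ _ _ _)
      | exact Set.mul_mem_mul (hx _ _ _ _) hz
      | exact sq (zPoly K n) ▸ Set.mul_mem_mul hz hz

/-! ### The Gröbner basis -/

theorem theorem4p1 (K : Type*) [Field K] (n : ℕ) [LinearOrder (XVar n)]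
    (hord : IsAdmissibleOrder (n := n)) :
    IsGroebnerBasis (dOrder n) (toricIdeal K n) (dBinomials K n) := by
  refine isGroebnerBasis_of_reduced_eq_zero _ _ _ (finite_dBinomials K n) ?_ ?_ ?_
  · intro h
    obtain ⟨u, hu⟩ := IsDBinomial.exists_isMarked hord h
    exact hu.ne_zero rfl
  · intro f hf
    obtain ⟨u, hu⟩ := IsDBinomial.exists_isMarked hord hf
    exact hu.mem_toricIdeal
  · intro r hr hred
    refine eq_zero_of_mem_toricIdeal K hr fun u hu v hv huv => ?_
    have hu' := isStandard_of_not_le K hord (hred u hu)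
    have hv' := isStandard_of_not_le K hord (hred v hv)
    rw [exponent_apply, exponent_apply, Prod.mk.injEq] at huv
    have hsome : u.some = v.some := by
      simpa using congrArg Multiset.toFinsupp (hu'.eq_of_weight_eq hv' huv.1)
    have hnone := huv.2
    rw [hsome, Nat.add_left_cancel_iff] at hnone
    refine Finsupp.ext fun a => ?_
    cases a with
    | none => exact hnone
    | some a => exact DFunLike.congr_fun hsome a
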